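/- Conventions. Monoids are cancellative. A commutative monoid $M$ with quotient group $q(M)$ is a Krull monoid if it satisfies the ascending chain condition on divisorial ideals (the ideals $\mathfrak a \subseteq M$ with $\mathfrak a = \mathfrak a_v = (\mathfrak a^{-1})^{-1}$, where $X^{-1} = \{a \in q(M) : aX \subseteq M\}$) and is completely integrally closed (if $x\in q(M)$, $c \in M$ and $cx^n\in M$ for all $n\ge 1$, then $x \in M$). A commutative domain $R$ is a Krull domain if $R^\bullet = R\setminus\{0\}$ is a Krull monoid. For $\varphi \in \mathrm{Aut}(R)$, the Krull domain $R$ is $\varphi$-$v$-simple if $\varphi(\mathfrak a) \neq \mathfrak a$ for every nonempty divisorial ideal $\mathfrak a \ne R^\bullet$ of $R^\bullet$. For a ring endomorphism $\sigma$ of a commutative ring $R$, the ring $R$ is $\sigma$-simple if $0$ and $R$ are the only ideals $I$ with $\sigma(I)R = I$; if $\sigma$ is an automorphism this condition reads $\sigma(I)=I$. $\mathcal F(P)$ is the free abelian monoid with basis $P$, and $D[H]$ is the semigroup algebra. A multiplicative subset is a multiplicatively closed subset, not required to contain $1$, and "generated" is meant in this sense. A field is regarded as a Dedekind domain. Lemma.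 Let $D$ be a commutative Krull domain, and let $H$ be a commutative Krull monoid containing a countably infinite set $P$ of pairwise non-associated prime elements. Suppose that $D[H]$ is a Krull domain. Then $H = H_0 \times \mathcal F(P)$ for some Krull submonoid $H_0$ of $H$, and for every submonoid $H_0$ with $H = H_0 \times \mathcal F(P)$ parts (1) and (2) hold: (1) There exists a multiplicative subset $S \subseteq D[H]^\bullet$ such that $S$ is generated by prime elements of $D[H]$, $S \cap D[H_0] = \emptyset$, and $S^{-1}D[H]$ is a Dedekind domain but not a field. (2) If $\varphi \in \mathrm{Aut}(D[H])$ is a ring automorphism with $\varphi(P) \subseteq P$, then $S$ in (1) can be chosen such that $\varphi(S) \subseteq S$, and moreover $\varphi(S) = S$ if $\varphi(P) = P$. (3) Let $S \subseteq D[H]^\bullet$ be any multiplicative subset such that $S^{-1}D[H]$ is a Dedekind domain, and let $\varphi \in \mathrm{Aut}(D[H])$ be such that $D[H]$ is $\varphi$-$v$-simple and $\varphi(S) \subseteq (S^{-1}D[H])^\times$. Then $\varphi$ extends to an injective endomorphism $\varphi_S$ of $S^{-1}D[H]$, and $S^{-1}D[H]$ is $\varphi_S$-simple. If also $\varphi^{-1}(S)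 \subseteq (S^{-1}D[H])^\times$ (for example, if $\varphi(S)=S$), then $\varphi$ extends to an automorphism $\varphi_S$ of $S^{-1}D[H]$, and $S^{-1}D[H]$ is $\varphi_S$-simple. -/

import Mathlib

section KrullMonoids

/-- The colon `(Y : X) = {a ∈ q(M) | a X ⊆ Y}` for subsets `X`, `Y` of the quotient group of `M`. -/
def quotColon {M : Type*} [CommMonoid M] (Y X : Set (Algebra.GrothendieckGroup M)) :
    Set (Algebra.GrothendieckGroup M) :=
  {a | ∀ x ∈ X, a * x ∈ Y}

/-- `X⁻¹ = (M : X)`, where `M` is viewed inside its quotient group. -/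
def quotInv {M : Type*} [CommMonoid M] (X : Set (Algebra.GrothendieckGroup M)) :
    Set (Algebra.GrothendieckGroup M) :=
  quotColon (Set.range (Algebra.GrothendieckGroup.of : M →* Algebra.GrothendieckGroup M)) X

/-- The divisorial closure `X_v = (X⁻¹)⁻¹`. -/
def quotVClosure {M : Type*} [CommMonoid M] (X : Set (Algebra.GrothendieckGroup M)) :
    Set (Algebra.GrothendieckGroup M) :=
  quotInv (quotInv X)

/-- Divisorial (integral) ideals of a commutative cancellative monoid `M`: subsets `I ⊆ M` with
`M I ⊆ I` and `I_v = I` (the latter computed in the quotient group). -/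
def IsDivisorialIdeal {M : Type*} [CommMonoid M] (I : Set M) : Prop :=
  (∀ (m : M), ∀ a ∈ I, m * a ∈ I) ∧
    quotVClosure ((Algebra.GrothendieckGroup.of : M →* Algebra.GrothendieckGroup M) '' I) =
      (Algebra.GrothendieckGroup.of : M →* Algebra.GrothendieckGroup M) '' I

/-- A commutative Krull monoid: a commutative cancellative monoid which satisfies the ascending
chain condition on divisorial ideals and is completely integrally closed. -/
structure IsKrullMonoid (M : Type*) [CommMonoid M] : Prop where
  isCancelMul : IsCancelMul M
  vNoetherian : ∀ I : ℕ → Set M, Monotone I → (∀ n, IsDivisorialIdeal (I n)) →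
    ∃ N, ∀ n, N ≤ n → I n = I N
  completelyIntegrallyClosed : ∀ x : Algebra.GrothendieckGroup M,
    (∃ c : M, ∀ n : ℕ, 1 ≤ n → Algebra.GrothendieckGroup.of c * x ^ n ∈
        Set.range (Algebra.GrothendieckGroup.of : M →* Algebra.GrothendieckGroup M)) →
      x ∈ Set.range (Algebra.GrothendieckGroup.of : M →* Algebra.GrothendieckGroup M)

/-- A commutative Krull domain: a domain whose monoid of nonzero elements is a Krull monoid. -/
structure IsKrullDomain (D : Type*) [CommRing D] : Prop where
  isDomain : IsDomain D
  isKrullMonoid : IsKrullMonoid (nonZeroDivisors D)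

/-- `M` is `τ`-`v`-simple: no nonempty proper divisorial ideal `I` of `M` satisfies `τ(I) = I`. -/
def IsVSimpleMonoid {M : Type*} [CommMonoid M] (τ : M ≃* M) : Prop :=
  ∀ I : Set M, IsDivisorialIdeal I → I.Nonempty → I ≠ Set.univ → τ '' I ≠ I

/-- The restriction of a ring automorphism to the monoid of non-zero-divisors
(for a domain: the nonzero elements). -/
noncomputable def RingEquiv.bullet {R : Type*} [CommRing R] (φ : R ≃+* R) :
    nonZeroDivisors R ≃* nonZeroDivisors R :=
  (φ.toMulEquiv.submonoidMap (nonZeroDivisors R)).trans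
    (MulEquiv.submonoidCongr (MulEquivClass.map_nonZeroDivisors φ.toMulEquiv))

/-- A domain `R` is `φ`-`v`-simple if its monoid of nonzero elements is. -/
def IsVSimple {R : Type*} [CommRing R] (φ : R ≃+* R) : Prop :=
  IsVSimpleMonoid φ.bullet

/-- `R` is `σ`-simple: the only ideals `I` with `σ(I) R = I` are `0` and `R`. For an automorphism
`σ` the set `σ(I)` is already an ideal, so that the condition then reads `σ(I) = I`. -/
def IsSigmaSimple {R : Type*} [CommRing R] (σ : R →+* R) : Prop :=
  ∀ I : Ideal R, I.map σ = I → I = ⊥ ∨ I = ⊤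

/-- Prime elements of a commutative (cancellative) monoid without zero. -/
def IsPrimeElement {M : Type*} [CommMonoid M] (p : M) : Prop :=
  ¬ IsUnit p ∧ ∀ a b : M, p ∣ a * b → p ∣ a ∨ p ∣ b

/-- `H = H₀ × F(P)` as an internal direct product: multiplication is a bijection
from `H₀ ×` (the free abelian monoid with basis `P`) onto `H`. -/
def IsFreeComplement {H : Type*} [CommMonoid H] (H₀ : Submonoid H) (P : Set H) : Prop :=
  Function.Bijective
    (fun x : H₀ × (P →₀ ℕ) => (x.1 : H) * x.2.prod (fun p n => (p : H) ^ n))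

end KrullMonoids

section Localizations

/-- The localization `S⁻¹R` at a multiplicatively closed set `S` (which need not contain `1`). -/
abbrev LocalizationAt {R : Type*} [CommRing R] (S : Subsemigroup R) : Type _ :=
  Localization (Submonoid.closure (S : Set R))

/-- `S` is a multiplicative set of nonzero elements of `D[H]`, generated by prime elements of
`D[H]` and disjoint from `D[H₀]`, such that `S⁻¹ D[H]` is a Dedekind domain but not a field. -/
structure IsDedekindLocalizer {D H : Type*} [CommRing D] [CommMonoid H] (H₀ : Submonoid H)
    (S : Subsemigroup (MonoidAlgebra D H)) : Prop where
  zero_notMem : (0 : MonoidAlgebra D H) ∉ S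
  generated : ∃ Q : Set (MonoidAlgebra D H), (∀ q ∈ Q, Prime q) ∧ S = Subsemigroup.closure Q
  disjoint : Disjoint (S : Set (MonoidAlgebra D H))
    (MonoidAlgebra.supported D D (H₀ : Set H) : Set (MonoidAlgebra D H))
  isDedekindDomain : IsDedekindDomain (LocalizationAt S)
  not_isField : ¬ IsField (LocalizationAt S)

end Localizations

open Algebra

/-! ### Divisorial closures and the Krull property in terms of divisibility -/

section MonoidDivisibility

variable {M : Type*} [CommMonoid M]

/-! Since `H = H₀ × F(P)`, the ring `D[H]` is a polynomial ring over `D[H₀]` in the infinitely many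
variables `P`. Call an ideal `L` v-trivial if `b ∣ cL` with `b ≠ 0` forces `b ∣ c`. In a Krull
domain every nonzero ideal `I` satisfies `aL ⊆ IJ ⊆ (a)` with `a ≠ 0` and `L` v-trivial
(`IsKrullDomain.exists_mul_le_span`). Hence inverting a multiplicative set that meets every
v-trivial ideal makes all nonzero ideals invertible (`IsKrullDomain.isDedekindDomain_localization`).

Let `S` be generated by the primes in the ideal `(P)` that are not associated to elements of `P`. A
v-trivial `L` contains a finite set `F` that is already v-trivial. Only finitely many variables
occur in `F`; with two fresh variables `y`, `z`, some `b ∈ F` and distinct positive exponents, `b y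
+ ∑ f z ^ n_f` lies in `L` and is one of these primes (`MvPolynomial.exists_prime_mem`). No element
of `P` becomes a unit, so the localization is not a field. As `S` depends on `P` alone,
automorphisms preserving `P` preserve `S`.

For simplicity, nonzero ideals of a Dedekind localization contract to divisorial ideals
(`IsKrullDomain.isDivisorialIdeal_comap`). A stable ideal thus gives a divisorial `I` with `φ(I) ⊆
I`; the chain condition upgrades this to equality, and v-simplicity forces `1 ∈ I`. -/

lemma of_div_of_mem_range_iff [IsCancelMul M] {a b : M} :
    GrothendieckGroup.of a / GrothendieckGroup.of b ∈
      Set.range (GrothendieckGroup.of : M →* GrothendieckGroup M) ↔ b ∣ a := by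
  constructor
  · rintro ⟨c, hc⟩
    rw [eq_div_iff_mul_eq', mul_comm, ← map_mul] at hc
    exact ⟨c, (GrothendieckGroup.of_injective hc).symm⟩
  · rintro ⟨c, rfl⟩
    exact ⟨c, by simp⟩

lemma exists_eq_of_div_of (x : GrothendieckGroup M) :
    ∃ a b : M, x = GrothendieckGroup.of a / GrothendieckGroup.of b := by
  induction x using Localization.ind with
  | H y =>
    refine ⟨y.1, y.2, ?_⟩
    rw [eq_div_iff_mul_eq', Localization.mk_eq_monoidOf_mk', mul_comm]
    exact (mul_comm _ _).trans ((Localization.monoidOf (⊤ : Submonoid M)).mk'_spec y.1 y.2)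

/-- The divisorial closure of a subset of a monoid, in terms of divisibility. -/
def dvdClosure (X : Set M) : Set M :=
  {x | ∀ a b : M, (∀ i ∈ X, b ∣ a * i) → b ∣ a * x}

lemma subset_dvdClosure (X : Set M) : X ⊆ dvdClosure X := fun _ hx _ _ h => h _ hx

lemma dvdClosure_mono {X Y : Set M} (h : X ⊆ Y) : dvdClosure X ⊆ dvdClosure Y :=
  fun _ hx a b hab => hx a b fun i hi => hab i (h hi)

lemma dvdClosure_dvdClosure (X : Set M) : dvdClosure (dvdClosure X) = dvdClosure X :=
  (subset_dvdClosure _).antisymm' fun _ hx a b hab => hx a b fun _ hi => hi a b hab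

lemma of_div_of_mem_quotInv_iff [IsCancelMul M] {X : Set M} {a b : M} :
    GrothendieckGroup.of a / GrothendieckGroup.of b ∈
      quotInv ((GrothendieckGroup.of : M →* GrothendieckGroup M) '' X) ↔ ∀ i ∈ X, b ∣ a * i := by
  simp only [quotInv, quotColon, Set.mem_ofPred_eq, Set.forall_mem_image]
  refine forall₂_congr fun i _ => ?_
  rw [div_mul_eq_mul_div, ← map_mul, of_div_of_mem_range_iff]

/-- Every fraction is some `a / b`, and it lies in `X⁻¹` exactly when `b` divides `aX`. This removes
the quotient group from all later arguments. -/
lemma quotVClosure_image_of [IsCancelMul M] (X : Set M) :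
    quotVClosure ((GrothendieckGroup.of : M →* GrothendieckGroup M) '' X) =
      (GrothendieckGroup.of : M →* GrothendieckGroup M) '' dvdClosure X := by
  have key : ∀ x : M, GrothendieckGroup.of x ∈
      quotVClosure ((GrothendieckGroup.of : M →* GrothendieckGroup M) '' X) ↔
      x ∈ dvdClosure X := by
    intro x
    constructor
    · intro hx a b hab
      have := hx _ (of_div_of_mem_quotInv_iff.2 hab)
      rwa [mul_comm, div_mul_eq_mul_div, ← map_mul, of_div_of_mem_range_iff] at this
    · intro hx y hy
      obtain ⟨a, b, rfl⟩ := exists_eq_of_div_of y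
      rw [mul_comm, div_mul_eq_mul_div, ← map_mul, of_div_of_mem_range_iff]
      exact hx a b (of_div_of_mem_quotInv_iff.1 hy)
  ext y
  constructor
  · intro hy
    -- Because `1 ∈ X⁻¹`, the closure `X_v` lies inside `M`.
    have h1 : (1 : GrothendieckGroup M) ∈
        quotInv ((GrothendieckGroup.of : M →* GrothendieckGroup M) '' X) := by
      rintro _ ⟨i, _, rfl⟩
      exact ⟨i, by simp⟩
    obtain ⟨x, hx⟩ := hy 1 h1
    rw [mul_one] at hx
    subst hx
    exact ⟨x, (key x).1 hy, rfl⟩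
  · rintro ⟨x, hx, rfl⟩
    exact (key x).2 hx

lemma isDivisorialIdeal_iff [IsCancelMul M] {I : Set M} :
    IsDivisorialIdeal I ↔ dvdClosure I = I := by
  rw [IsDivisorialIdeal, quotVClosure_image_of,
    (Set.image_injective.2 GrothendieckGroup.of_injective).eq_iff]
  refine ⟨fun h => h.2, fun h => ⟨fun m a ha => ?_, h⟩⟩
  rw [← h] at ha ⊢
  intro x y hxy
  rw [mul_left_comm]
  exact (ha x y hxy).mul_left m

lemma IsDivisorialIdeal.dvdClosure_eq [IsCancelMul M] {I : Set M} (h : IsDivisorialIdeal I) :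
    dvdClosure I = I := isDivisorialIdeal_iff.1 h

lemma isDivisorialIdeal_dvdClosure [IsCancelMul M] (X : Set M) :
    IsDivisorialIdeal (dvdClosure X) :=
  isDivisorialIdeal_iff.2 (dvdClosure_dvdClosure X)

lemma dvdClosure_singleton (x : M) : dvdClosure {x} = {y | x ∣ y} := by
  ext y
  constructor
  · intro h
    simpa using h 1 x (by simp)
  · rintro ⟨c, rfl⟩ a b h
    rw [← mul_assoc]
    exact (h x rfl).mul_right c

namespace IsKrullMonoid

variable (hM : IsKrullMonoid M)
include hM

/-- By the chain condition, some closure of a finite subset of `X` is maximal among such closures;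
adjoining one more element of `X` cannot enlarge it. -/
lemma exists_finite_subset_dvdClosure (X : Set M) :
    ∃ F ⊆ X, F.Finite ∧ X ⊆ dvdClosure F := by
  have := hM.isCancelMul
  have wf : WellFoundedGT {I : Set M // IsDivisorialIdeal I} := by
    refine wellFoundedGT_iff_monotone_chain_condition.2 fun a => ?_
    obtain ⟨N, hN⟩ := hM.vNoetherian (fun n => (a n).1) (fun i j hij => a.mono hij)
      (fun n => (a n).2)
    exact ⟨N, fun m hm => Subtype.ext (hN m hm).symm⟩
  obtain ⟨_, ⟨F, hFX, hF, rfl⟩, hmax⟩ := wf.wf.has_min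
    {I | ∃ F ⊆ X, F.Finite ∧ I = ⟨dvdClosure F, isDivisorialIdeal_dvdClosure F⟩}
    ⟨_, ∅, Set.empty_subset _, Set.finite_empty, rfl⟩
  refine ⟨F, hFX, hF, fun x hx => ?_⟩
  by_contra hxF
  refine hmax ⟨dvdClosure (insert x F), isDivisorialIdeal_dvdClosure _⟩
    ⟨insert x F, Set.insert_subset hx hFX, hF.insert x, rfl⟩ ?_
  refine lt_of_le_of_ne (dvdClosure_mono (Set.subset_insert x F)) fun h => hxF ?_
  rw [Subtype.mk.injEq] at h
  rw [h]
  exact subset_dvdClosure _ (Set.mem_insert x F)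

lemma dvd_of_forall_pow_dvd {a b c : M} (h : ∀ n : ℕ, 1 ≤ n → b ^ n ∣ c * a ^ n) : b ∣ a := by
  have := hM.isCancelMul
  rw [← of_div_of_mem_range_iff]
  refine hM.completelyIntegrallyClosed _ ⟨c, fun n hn => ?_⟩
  rw [div_pow, ← mul_div_assoc, ← map_pow, ← map_pow, ← map_mul, of_div_of_mem_range_iff]
  exact h n hn

/-- Principal ideals are divisorial, so a chain of proper divisors would give a strictly ascending
chain of divisorial ideals. -/
lemma wellFounded_dvdNotUnit : WellFounded fun a b : M => a ∣ b ∧ ¬ b ∣ a := by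
  have := hM.isCancelMul
  rw [wellFounded_iff_isEmpty_descending_chain]
  refine ⟨fun ⟨f, hf⟩ => ?_⟩
  have hdvd : ∀ m n, m ≤ n → f n ∣ f m := by
    intro m n hmn
    induction n, hmn using Nat.le_induction with
    | base => exact dvd_rfl
    | succ n _ ih => exact (hf n).1.trans ih
  obtain ⟨N, hN⟩ := hM.vNoetherian (fun n => dvdClosure {f n})
    (fun m n hmn => by
      simp only [dvdClosure_singleton]
      exact fun y hy => (hdvd m n hmn).trans hy)
    (fun n => isDivisorialIdeal_dvdClosure _)
  have h := hN (N + 1) (Nat.le_succ N)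
  simp only [dvdClosure_singleton] at h
  exact (hf N).2 (h.le (dvd_refl (f (N + 1))))

/-- A submonoid closed under taking quotients inherits the Krull property. -/
lemma submonoid {N : Submonoid M} (hN : ∀ a b : M, b ∈ N → b * a ∈ N → a ∈ N) :
    IsKrullMonoid N := by
  have := hM.isCancelMul
  have dvd_iff : ∀ a b : N, (a : M) ∣ b ↔ a ∣ b := by
    refine fun a b => ⟨fun ⟨c, hc⟩ => ⟨⟨c, hN c a a.2 (hc ▸ b.2)⟩, Subtype.ext hc⟩, ?_⟩
    rintro ⟨c, rfl⟩
    exact ⟨c, rfl⟩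
  have hcancel : IsCancelMul N :=
    { mul_left_cancel := fun a b c h => Subtype.ext (mul_left_cancel (congrArg Subtype.val h))
      mul_right_cancel := fun a b c h => Subtype.ext (mul_right_cancel (congrArg Subtype.val h)) }
  refine ⟨hcancel, fun I hI hdiv => ?_, ?_⟩
  · obtain ⟨n, hn⟩ := hM.vNoetherian (fun n => dvdClosure (Subtype.val '' I n))
      (fun i j hij => dvdClosure_mono (Set.image_mono (hI hij)))
      (fun n => isDivisorialIdeal_dvdClosure _)
    -- A divisorial ideal of `N` is recovered by contracting its closure in `M`, since divisibility
    -- in `N` is that of `M`.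
    have hcontr : ∀ n, I n = Subtype.val ⁻¹' dvdClosure (Subtype.val '' I n) := by
      refine fun n => Set.Subset.antisymm
        (fun x hx => subset_dvdClosure _ (Set.mem_image_of_mem _ hx)) fun x hx => ?_
      rw [← (hdiv n).dvdClosure_eq]
      intro a b hab
      rw [← dvd_iff]
      refine hx a b ?_
      rintro _ ⟨i, hi, rfl⟩
      exact (dvd_iff _ _).2 (hab i hi)
    exact ⟨n, fun m hm => by rw [hcontr m, hcontr n, hn m hm]⟩
  · rintro x ⟨c, hc⟩
    obtain ⟨a, b, rfl⟩ := exists_eq_of_div_of x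
    rw [of_div_of_mem_range_iff, ← dvd_iff]
    refine hM.dvd_of_forall_pow_dvd (c := c) fun n hn => ?_
    have := hc n hn
    rw [div_pow, ← mul_div_assoc, ← map_pow, ← map_pow, ← map_mul, of_div_of_mem_range_iff,
      ← dvd_iff] at this
    exact this

end IsKrullMonoid

end MonoidDivisibility

/-! ### Splitting off a free factor generated by primes -/

section FreeComplement

variable {H : Type*} [CommMonoid H]

namespace IsPrimeElement

variable {p : H} (hp : IsPrimeElement p)
include hp

lemma dvd_of_dvd_pow {q : H} {n : ℕ} (h : p ∣ q ^ n) : p ∣ q := by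
  induction n with
  | zero => exact (hp.1 (isUnit_of_dvd_one (by simpa using h))).elim
  | succ n ih => exact (hp.2 _ _ (pow_succ q n ▸ h)).elim ih id

lemma exists_dvd_of_dvd_finset_prod {ι : Type*} {s : Finset ι} {f : ι → H}
    (h : p ∣ ∏ i ∈ s, f i) : ∃ i ∈ s, p ∣ f i := by
  classical
  induction s using Finset.induction_on with
  | empty => exact (hp.1 (isUnit_of_dvd_one (by simpa using h))).elim
  | insert i s hi ih =>
    rw [Finset.prod_insert hi] at h
    rcases hp.2 _ _ h with h | h
    · exact ⟨i, Finset.mem_insert_self i s, h⟩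
    · obtain ⟨j, hj, hpj⟩ := ih h
      exact ⟨j, Finset.mem_insert_of_mem hj, hpj⟩

lemma associated_of_dvd [IsCancelMul H] {q : H} (hq : IsPrimeElement q) (h : p ∣ q) :
    Associated p q := by
  obtain ⟨c, rfl⟩ := h
  rcases hq.2 p c dvd_rfl with ⟨d, hd⟩ | ⟨d, hd⟩
  · have : c * d = 1 := mul_left_cancel (a := p) (by rw [← mul_assoc, ← hd, mul_one])
    exact ⟨Units.mkOfMulEqOne c d this, rfl⟩
  · have : p * d = 1 := mul_left_cancel (a := c) (by rw [mul_one, ← mul_assoc, mul_comm c, ← hd])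
    exact (hp.1 (IsUnit.of_mul_eq_one d this)).elim

end IsPrimeElement

/-- The elements which are not divisible by any element of a given set of primes. -/
def coprimeSubmonoid (P : Set H) (hP : ∀ p ∈ P, IsPrimeElement p) : Submonoid H where
  carrier := {h | ∀ p ∈ P, ¬ p ∣ h}
  one_mem' p hp h := (hP p hp).1 (isUnit_of_dvd_one h)
  mul_mem' ha hb p hp h := ((hP p hp).2 _ _ h).elim (ha p hp) (hb p hp)

/-- The exponents of a factorization can be read off from divisibility, which gives uniqueness of
the decomposition. -/
lemma pow_dvd_mul_prod_iff [IsCancelMul H] {P : Set H} (hP : ∀ p ∈ P, IsPrimeElement p)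
    (hna : P.Pairwise fun p q => ¬ Associated p q) {x : H} (hx : x ∈ coprimeSubmonoid P hP)
    (n : P →₀ ℕ) (p : P) (k : ℕ) :
    (p : H) ^ k ∣ x * n.prod (fun q j => (q : H) ^ j) ↔ k ≤ n p := by
  rw [← Finsupp.mul_prod_erase' n p (fun q j => (q : H) ^ j) (by simp), mul_left_comm]
  refine ⟨fun h => ?_, fun h => (pow_dvd_pow _ h).mul_right _⟩
  by_contra! hk
  obtain ⟨c, hc⟩ := (pow_dvd_pow (p : H) hk).trans h
  rw [pow_succ, mul_assoc] at hc
  rcases (hP p p.2).2 _ _ ⟨c, mul_left_cancel hc⟩ with h | h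
  · exact hx p p.2 h
  · obtain ⟨q, hq, hpq⟩ := (hP p p.2).exists_dvd_of_dvd_finset_prod h
    have hne : q ≠ p := by
      rintro rfl
      simp at hq
    exact hna p.2 q.2 (fun h => hne (Subtype.ext h.symm))
      ((hP p p.2).associated_of_dvd (hP q q.2) ((hP p p.2).dvd_of_dvd_pow hpq))

lemma IsKrullMonoid.isFreeComplement_coprimeSubmonoid (hH : IsKrullMonoid H) {P : Set H}
    (hP : ∀ p ∈ P, IsPrimeElement p) (hna : P.Pairwise fun p q => ¬ Associated p q) :
    IsFreeComplement (coprimeSubmonoid P hP) P := by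
  have := hH.isCancelMul
  constructor
  · rintro ⟨x, n⟩ ⟨y, m⟩ h
    dsimp only at h
    obtain rfl : n = m := by
      ext p
      refine le_antisymm ?_ ?_
      · rw [← pow_dvd_mul_prod_iff hP hna y.2, ← h, pow_dvd_mul_prod_iff hP hna x.2]
      · rw [← pow_dvd_mul_prod_iff hP hna x.2, h, pow_dvd_mul_prod_iff hP hna y.2]
    rw [Subtype.ext (mul_right_cancel h)]
  · intro h
    -- Existence: split off primes of `P` one at a time; this terminates because each quotient is a
    -- proper divisor.
    induction h using hH.wellFounded_dvdNotUnit.induction with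
    | _ h ih =>
    by_cases hh : h ∈ coprimeSubmonoid P hP
    · exact ⟨(⟨h, hh⟩, 0), by simp⟩
    · obtain ⟨p, hp, g, rfl⟩ : ∃ p ∈ P, p ∣ h := by simpa [coprimeSubmonoid] using hh
      obtain ⟨⟨x, n⟩, rfl⟩ := ih g ⟨dvd_mul_left _ _, fun ⟨c, hc⟩ => (hP p hp).1
        (IsUnit.of_mul_eq_one c (mul_left_cancel (a := g)
          (by rw [mul_one, ← mul_assoc, mul_comm g, ← hc])))⟩
      refine ⟨(x, Finsupp.single ⟨p, hp⟩ 1 + n), ?_⟩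
      dsimp only
      rw [Finsupp.prod_add_index' (by simp) (fun _ _ _ => pow_add _ _ _),
        Finsupp.prod_single_index (by simp), pow_one, mul_left_comm]

lemma IsKrullMonoid.coprimeSubmonoid (hH : IsKrullMonoid H) {P : Set H}
    (hP : ∀ p ∈ P, IsPrimeElement p) : IsKrullMonoid (coprimeSubmonoid P hP) :=
  hH.submonoid fun _ _ _ h p hp hpa => h p hp (hpa.mul_left _)

end FreeComplement

/-! ### Transfer from the monoid of nonzero elements to the domain -/

section KrullDomain

open nonZeroDivisors

variable {R : Type*} [CommRing R]

lemma nonZeroDivisors_coe_dvd_iff {a b : R⁰} : (a : R) ∣ b ↔ a ∣ b := by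
  refine ⟨fun ⟨c, hc⟩ => ⟨⟨c, ?_⟩, Subtype.ext hc⟩, fun ⟨c, hc⟩ => ⟨c, by rw [hc]; rfl⟩⟩
  exact (mul_mem_nonZeroDivisors.1 (hc ▸ b.2)).2

namespace IsKrullDomain

variable (hR : IsKrullDomain R)
include hR

/-- Finiteness of `F` is what later allows the choice of fresh variables and of common denominators.
-/
lemma exists_finset_forall_dvd (I : Ideal R) :
    ∃ F : Finset R, (F : Set R) ⊆ I ∧ (0 ∉ F) ∧
      ∀ a b : R, b ≠ 0 → (∀ f ∈ F, b ∣ a * f) → ∀ x ∈ I, b ∣ a * x := by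
  have := hR.isDomain
  obtain ⟨F, hFX, hF, hX⟩ := hR.isKrullMonoid.exists_finite_subset_dvdClosure
    (Subtype.val ⁻¹' (I : Set R))
  classical
  refine ⟨hF.toFinset.image Subtype.val, ?_, ?_, fun a b hb hab x hx => ?_⟩
  · intro x hx
    obtain ⟨y, hy, rfl⟩ := by simpa only [Finset.coe_image, Set.mem_image] using hx
    exact hFX (by simpa using hy)
  · simp
  · rcases eq_or_ne a 0 with rfl | ha
    · simp
    rcases eq_or_ne x 0 with rfl | hx0
    · simp
    have := @hX ⟨x, mem_nonZeroDivisors_of_ne_zero hx0⟩ hx ⟨a, mem_nonZeroDivisors_of_ne_zero ha⟩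
      ⟨b, mem_nonZeroDivisors_of_ne_zero hb⟩ fun i hi => nonZeroDivisors_coe_dvd_iff.1
        (hab i (Finset.mem_image_of_mem _ (hF.mem_toFinset.2 hi)))
    exact nonZeroDivisors_coe_dvd_iff.2 this

lemma dvd_of_forall_pow_dvd {a b c : R} (hb : b ≠ 0) (hc : c ≠ 0)
    (h : ∀ n : ℕ, 1 ≤ n → b ^ n ∣ c * a ^ n) : b ∣ a := by
  have := hR.isDomain
  rcases eq_or_ne a 0 with rfl | ha
  · simp
  refine nonZeroDivisors_coe_dvd_iff.2 (hR.isKrullMonoid.dvd_of_forall_pow_dvd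
    (a := ⟨a, mem_nonZeroDivisors_of_ne_zero ha⟩) (b := ⟨b, mem_nonZeroDivisors_of_ne_zero hb⟩)
    (c := ⟨c, mem_nonZeroDivisors_of_ne_zero hc⟩) fun n hn => ?_)
  exact nonZeroDivisors_coe_dvd_iff.1 (h n hn)

end IsKrullDomain

end KrullDomain

/-! ### Invertibility of ideals and Dedekind localizations -/

section Invertibility

open nonZeroDivisors

variable {R : Type*} [CommRing R]

/-- In a Krull domain every nonzero ideal is `v`-invertible. -/
lemma IsKrullDomain.exists_mul_le_span (hR : IsKrullDomain R) {I : Ideal R} (hI : I ≠ ⊥) :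
    ∃ (a : R) (J L : Ideal R), a ≠ 0 ∧ I * J ≤ Ideal.span {a} ∧
      (∀ l ∈ L, a * l ∈ I * J) ∧ ∀ c b : R, b ≠ 0 → (∀ l ∈ L, b ∣ c * l) → b ∣ c := by
  have := hR.isDomain
  obtain ⟨a, haI, ha⟩ := Submodule.exists_mem_ne_zero_of_ne_bot hI
  -- `J` is `a I⁻¹` and `L` is `I I⁻¹`, written without fractions.
  let J : Ideal R := (Ideal.span {a}).colon (I : Set R)
  have memJ : ∀ {x}, x ∈ J ↔ ∀ i ∈ I, a ∣ x * i := by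
    intro x
    simp [J, Submodule.mem_colon, Ideal.mem_span_singleton]
  let L : Ideal R := Submodule.comap (LinearMap.mulLeft R a) (I * J)
  have memL : ∀ {l}, l ∈ L ↔ a * l ∈ I * J := Iff.rfl
  refine ⟨a, J, L, ha, ?_, fun l hl => hl, fun c b hb hbc => ?_⟩
  · rw [Ideal.mul_le]
    intro i hi j hj
    rw [Ideal.mem_span_singleton, mul_comm]
    exact memJ.1 hj i hi
  -- With `x = c / b`, `x I I⁻¹ ⊆ R` gives `xJ ⊆ J`. Iterating from `a ∈ J` yields `a xⁿ ∈ R` for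
  -- all `n`, so complete integral closedness applies.
  have step : ∀ j ∈ J, ∃ j' ∈ J, c * j = b * j' := by
    intro j hj
    have key : ∀ i ∈ I, a * b ∣ c * j * i := by
      intro i hi
      obtain ⟨l, hl⟩ := memJ.1 hj i hi
      have : l ∈ L := memL.2 (by rw [← hl, mul_comm j]; exact Ideal.mul_mem_mul hi hj)
      rw [mul_assoc, hl, mul_left_comm]
      exact mul_dvd_mul_left a (hbc l this)
    obtain ⟨j', hj'⟩ : b ∣ c * j := by
      have := key a haI
      rw [mul_comm a b] at this
      exact (mul_dvd_mul_iff_right ha).1 this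
    refine ⟨j', memJ.2 fun i hi => ?_, hj'⟩
    have := key i hi
    rw [hj', mul_comm a b, mul_assoc] at this
    exact (mul_dvd_mul_iff_left hb).1 this
  have haJ : a ∈ J := memJ.2 fun i _ => dvd_mul_right a i
  have hpow : ∀ n : ℕ, ∃ j ∈ J, a * c ^ n = b ^ n * j := by
    intro n
    induction n with
    | zero => exact ⟨a, haJ, by simp⟩
    | succ n ih =>
      obtain ⟨j, hj, h⟩ := ih
      obtain ⟨j', hj', h'⟩ := step j hj
      refine ⟨j', hj', ?_⟩
      rw [pow_succ, ← mul_assoc, h, mul_assoc, mul_comm j, h', pow_succ, mul_assoc]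
  refine hR.dvd_of_forall_pow_dvd hb ha fun n _ => ?_
  obtain ⟨j, _, h⟩ := hpow n
  exact ⟨j, h⟩

/-- Up to a nonzero principal factor a fractional ideal is integral, and an integral ideal dividing
an invertible one is invertible. -/
lemma isDedekindDomain_of_forall_exists_mul_eq_span {T : Type*} [CommRing T] [IsDomain T]
    (h : ∀ I : Ideal T, I ≠ ⊥ → ∃ (J : Ideal T) (a : T), a ≠ 0 ∧ I * J = Ideal.span {a}) :
    IsDedekindDomain T := by
  rw [isDedekindDomain_iff_mul_inv_cancel (K := FractionRing T)]
  intro I hI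
  rw [FractionalIdeal.mul_inv_cancel_iff_isUnit]
  obtain ⟨d, I', hd, rfl⟩ := FractionalIdeal.exists_eq_spanSingleton_mul I
  have hunit : ∀ x : FractionRing T, x ≠ 0 → IsUnit (FractionalIdeal.spanSingleton T⁰ x) :=
    fun x hx => IsUnit.of_mul_eq_one (FractionalIdeal.spanSingleton T⁰ x⁻¹) (by
      rw [FractionalIdeal.spanSingleton_mul_spanSingleton, mul_inv_cancel₀ hx,
        FractionalIdeal.spanSingleton_one])
  have hmap : ∀ x : T, x ≠ 0 → algebraMap T (FractionRing T) x ≠ 0 := fun x hx => by simpa using hx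
  refine (hunit _ (inv_ne_zero (hmap d hd))).mul ?_
  obtain ⟨J, a, ha, hJ⟩ := h I' (by rintro rfl; simp at hI)
  have := hunit _ (hmap a ha)
  rw [← FractionalIdeal.coeIdeal_span_singleton, ← hJ, FractionalIdeal.coeIdeal_mul] at this
  exact isUnit_of_mul_isUnit_left this

/-- A localization of a Krull domain in which all `v`-trivial ideals blow up is Dedekind. -/
lemma IsKrullDomain.isDedekindDomain_localization (hR : IsKrullDomain R) (S : Submonoid R)
    (h0 : 0 ∉ S) (T : Type*) [CommRing T] [Algebra R T] [IsLocalization S T]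
    (h : ∀ L : Ideal R, (∀ c b : R, b ≠ 0 → (∀ l ∈ L, b ∣ c * l) → b ∣ c) → ∃ s ∈ S, s ∈ L) :
    IsDedekindDomain T := by
  have := hR.isDomain
  have hS : S ≤ R⁰ := le_nonZeroDivisors_of_noZeroDivisors h0
  have : IsDomain T := IsLocalization.isDomain_of_le_nonZeroDivisors T hS
  have hinj : Function.Injective (algebraMap R T) := IsLocalization.injective T hS
  refine isDedekindDomain_of_forall_exists_mul_eq_span fun I hI => ?_
  have hI0 : I.comap (algebraMap R T) ≠ ⊥ := by
    intro hbot
    apply hI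
    rw [← IsLocalization.map_under S T I, Ideal.under_def, hbot, Ideal.map_bot]
  obtain ⟨a, J, L, ha, hle, hL, htriv⟩ := hR.exists_mul_le_span hI0
  -- Now `a s ∈ IJ` with `s` invertible in `T`, so `IJ` extends to exactly `aT`.
  obtain ⟨s, hs, hsL⟩ := h L htriv
  refine ⟨J.map (algebraMap R T), algebraMap R T a, by simpa using hinj.ne ha, ?_⟩
  have hmap : (I.comap (algebraMap R T)).map (algebraMap R T) = I :=
    IsLocalization.map_under S T I
  rw [← hmap, ← Ideal.map_mul]
  refine le_antisymm ?_ ?_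
  · rw [← Set.image_singleton, ← Ideal.map_span]
    exact Ideal.map_mono hle
  · rw [Ideal.span_singleton_le_iff_mem]
    have h1 := Ideal.mem_map_of_mem (algebraMap R T) (hL s hsL)
    rw [map_mul] at h1
    exact (Ideal.mul_unit_mem_iff_mem _ (IsLocalization.map_units T ⟨s, hs⟩)).1 h1

end Invertibility

/-! ### Primality of linear polynomials -/

section PrimeLinearForm

open Polynomial

/-- A linear polynomial `bX + a` over a domain is prime if `a` is regular modulo `b`. -/
lemma Polynomial.prime_C_mul_X_add_C {B : Type*} [CommRing B] [IsDomain B] {a b : B} (hb : b ≠ 0)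
    (h : ∀ c, b ∣ a * c → b ∣ c) : Prime (C b * X + C a) := by
  have hpow : ∀ (n : ℕ) (c : B), b ∣ a ^ n * c → b ∣ c := by
    intro n
    induction n with
    | zero => simp
    | succ n ih => exact fun c hc => ih c (h _ (by rwa [pow_succ', mul_assoc] at hc))
  let K := FractionRing B
  let ψ : B[X] →+* K := eval₂RingHom (algebraMap B K) (-(algebraMap B K a / algebraMap B K b))
  have hbK : algebraMap B K b ≠ 0 := by simpa using hb
  have hψf : ψ (C b * X + C a) = 0 := by
    simp only [ψ, coe_eval₂RingHom, eval₂_add, eval₂_mul, eval₂_C, eval₂_X]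
    rw [mul_neg, mul_div_cancel₀ _ hbK, neg_add_cancel]
  -- The kernel of evaluation at `-a / b` is generated by `bX + a`, by induction on the degree:
  -- clearing denominators in `g(-a / b) = 0` shows that `b` divides the top coefficient, which can
  -- then be cancelled.
  have hker : ∀ (n : ℕ) (g : B[X]), g.natDegree ≤ n → ψ g = 0 → C b * X + C a ∣ g := by
    intro n
    induction n with
    | zero =>
      intro g hg hψ
      rw [eq_C_of_natDegree_le_zero hg] at hψ ⊢
      have : g.coeff 0 = 0 := by simpa [ψ] using hψ
      simp [this]
    | succ n ih =>
      intro g hg hψ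
      have hlead : b ∣ a ^ (n + 1) * g.coeff (n + 1) := by
        have hsum : ∑ i ∈ Finset.range (n + 2), g.coeff i * (-a) ^ i * b ^ (n + 1 - i) = 0 := by
          apply IsFractionRing.injective B K
          have h0 := congrArg (· * algebraMap B K b ^ (n + 1)) hψ
          simp only [ψ, coe_eval₂RingHom, zero_mul] at h0
          rw [eval₂_eq_sum_range' _ (Nat.lt_succ_of_le hg), Finset.sum_mul] at h0
          rw [map_sum, map_zero, ← h0]
          refine Finset.sum_congr rfl fun i hi => ?_
          have hi' : n + 1 = i + (n + 1 - i) := by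
            have := Finset.mem_range.1 hi
            omega
          have hpw : algebraMap B K b ^ (n + 1) =
              algebraMap B K b ^ i * algebraMap B K b ^ (n + 1 - i) := by rw [← pow_add, ← hi']
          rw [hpw, map_mul, map_mul, map_pow, map_pow, map_neg, mul_assoc, mul_assoc, ← mul_assoc,
            ← mul_assoc (_ ^ i) (_ ^ i), ← mul_pow, ← mul_assoc]
          congr 3
          rw [neg_mul, div_mul_cancel₀ _ hbK]
        rw [Finset.sum_range_succ, add_eq_zero_iff_neg_eq] at hsum
        have hdvd : b ∣ g.coeff (n + 1) * (-a) ^ (n + 1) * b ^ (n + 1 - (n + 1)) := by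
          rw [← hsum, dvd_neg]
          refine Finset.dvd_sum fun i hi => Dvd.dvd.mul_left (dvd_pow_self b ?_) _
          have := Finset.mem_range.1 hi
          omega
        rw [Nat.sub_self, pow_zero, mul_one, neg_pow, mul_comm, mul_assoc] at hdvd
        exact ((isUnit_one.neg.pow _).dvd_mul_left).1 hdvd
      obtain ⟨d, hd⟩ := hpow _ _ hlead
      have hsub : C b * X + C a ∣ g - (C b * X + C a) * (C d * X ^ n) := by
        refine ih _ ?_ (by rw [map_sub, map_mul, hψf, hψ]; simp)
        rw [natDegree_le_iff_coeff_eq_zero]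
        intro N hN
        have : (C b * X + C a) * (C d * X ^ n) = C (b * d) * X ^ (n + 1) + C (a * d) * X ^ n := by
          simp only [C_mul]
          ring
        rw [this, coeff_sub, coeff_add, coeff_C_mul_X_pow, coeff_C_mul_X_pow,
          if_neg (show N ≠ n by omega), add_zero]
        split_ifs with h1
        · rw [h1, hd, sub_self]
        · rw [sub_zero, coeff_eq_zero_of_natDegree_lt (by omega)]
      exact (dvd_sub_left (dvd_mul_right _ _)).1 hsub
  refine ⟨fun h0 => hb ?_, fun hu => ?_, fun g₁ g₂ hg => ?_⟩
  · simpa using congrArg (coeff · 1) h0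
  · have := hu.map ψ
    rw [hψf] at this
    exact not_isUnit_zero this
  · obtain ⟨q, hq⟩ := hg
    have : ψ g₁ * ψ g₂ = 0 := by rw [← map_mul, hq, map_mul, hψf, zero_mul]
    exact (mul_eq_zero.1 this).imp (hker _ _ le_rfl) (hker _ _ le_rfl)

end PrimeLinearForm

/-! ### Regularity modulo a constant -/

section RegularModulo

open Polynomial

lemma Polynomial.C_dvd_C_iff {B : Type*} [CommRing B] {a b : B} : C a ∣ C b ↔ a ∣ b :=
  ⟨fun h => by simpa using (C_dvd_iff_dvd_coeff a (C b)).1 h 0, _root_.map_dvd C⟩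

lemma Polynomial.coeff_sum_C_mul_X_pow {B ι : Type*} [CommRing B] [Fintype ι] (f : ι → B)
    {n : ι → ℕ} (hn : Function.Injective n) (j : ι) :
    (∑ i, C (f i) * X ^ n i : B[X]).coeff (n j) = f j := by
  rw [finsetSum_coeff, Finset.sum_eq_single j]
  · simp
  · intro i _ hij
    rw [coeff_C_mul_X_pow, if_neg fun h => hij (hn h.symm)]
  · simp

/-- If the coefficients of `∑ fᵢ X ^ nᵢ` have no common annihilator modulo `b`, then this
polynomial is regular modulo `b`. -/
lemma Polynomial.C_dvd_of_C_dvd_mul {B ι : Type*} [CommRing B] [Fintype ι] {b : B} {f : ι → B}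
    {n : ι → ℕ} (hn : Function.Injective n) (h : ∀ c, (∀ i, b ∣ c * f i) → b ∣ c) {q : B[X]}
    (hq : C b ∣ (∑ i, C (f i) * X ^ n i) * q) : C b ∣ q := by
  let π := Ideal.Quotient.mk (Ideal.span {b})
  have hπ : ∀ c, π c = 0 ↔ b ∣ c := fun c => by
    rw [Ideal.Quotient.eq_zero_iff_mem, Ideal.mem_span_singleton]
  have hmap : ∀ p : B[X], p.map π = 0 ↔ C b ∣ p := fun p => by
    simp [C_dvd_iff_dvd_coeff, Polynomial.ext_iff, hπ]
  rw [← hmap] at hq ⊢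
  rw [Polynomial.map_mul] at hq
  refine (mul_left_mem_nonZeroDivisors_eq_zero_iff ?_).1 hq
  -- McCoy's theorem: a zero divisor in a polynomial ring is killed by a nonzero constant, so only
  -- constants need testing.
  rw [Polynomial.mem_nonZeroDivisors_iff]
  intro a ha
  obtain ⟨c, rfl⟩ := Ideal.Quotient.mk_surjective a
  refine (hπ c).2 (h c fun i => (hπ _).1 ?_)
  have := congrArg (coeff · (n i)) ha
  simpa [coeff_sum_C_mul_X_pow f hn i, -map_sum] using this

end RegularModulo

/-! ### Primes in v-trivial ideals of a polynomial ring -/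

namespace MvPolynomial

variable {σ A : Type*} [CommRing A]

open scoped Classical in
/-- Polynomials in the variables `σ` as polynomials in one distinguished variable `y`. -/
noncomputable def isolate (A : Type*) [CommRing A] (y : σ) :
    MvPolynomial σ A ≃ₐ[A] Polynomial (MvPolynomial {x // x ≠ y} A) :=
  (renameEquiv A (Equiv.optionSubtypeNe y).symm).trans (optionEquivLeft A {x // x ≠ y})

lemma isolate_X_self (y : σ) : isolate A y (X y) = Polynomial.X := by
  simp [isolate, optionEquivLeft_X_none]

lemma isolate_X_of_ne {y x : σ} (h : x ≠ y) :
    isolate A y (X x) = Polynomial.C (X ⟨x, h⟩) := by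
  simp [isolate, dif_neg h, optionEquivLeft_X_some]

lemma isolate_rename (y : σ) (p : MvPolynomial {x // x ≠ y} A) :
    isolate A y (rename Subtype.val p) = Polynomial.C p := by
  induction p using MvPolynomial.induction_on with
  | C a => rw [rename_C, ← algebraMap_eq, AlgEquiv.commutes]; rfl
  | add p q hp hq => simp [hp, hq]
  | mul_X p x hp => rw [map_mul, map_mul, hp, rename_X, isolate_X_of_ne x.2, Polynomial.C_mul]

lemma exists_isolate_eq_C {y : σ} {p : MvPolynomial σ A} (h : y ∉ p.vars) :
    ∃ q, isolate A y p = Polynomial.C q := by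
  obtain ⟨q, rfl⟩ := exists_rename_eq_of_vars_subset_range p
    (Subtype.val : {x // x ≠ y} → σ) Subtype.val_injective (fun x hx => by
      simpa using (ne_of_mem_of_not_mem hx h))
  exact ⟨q, isolate_rename y q⟩

/-- The linear form `b X_y + ∑ fᵢ X_z ^ nᵢ` is prime if `y`, `z` are new variables and the `fᵢ`
have no common annihilator modulo `b`. -/
lemma prime_linearForm [IsDomain A] {ι : Type*} [Fintype ι] {b : MvPolynomial σ A}
    {f : ι → MvPolynomial σ A} {n : ι → ℕ} (hn : Function.Injective n) (hb : b ≠ 0)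
    (h : ∀ c, (∀ i, b ∣ c * f i) → b ∣ c) {y z : σ} (hyz : z ≠ y)
    (hby : y ∉ b.vars) (hbz : z ∉ b.vars) (hfy : ∀ i, y ∉ (f i).vars) (hfz : ∀ i, z ∉ (f i).vars) :
    Prime (b * X y + ∑ i, f i * X z ^ n i) := by
  -- Regularity modulo `b` is checked in the variable `z`, where injectivity of `n` keeps the `f i`
  -- as separate coefficients. Primality is then checked in `y`, where the form is linear.
  have hreg : ∀ q, b ∣ (∑ i, f i * X z ^ n i) * q → b ∣ q := by
    obtain ⟨b', hb'⟩ := exists_isolate_eq_C hbz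
    choose f' hf' using fun i => exists_isolate_eq_C (hfz i)
    intro q hq
    rw [← map_dvd_iff (isolate A z)] at hq ⊢
    simp only [map_mul, map_sum, map_pow, hb', hf', isolate_X_self] at hq ⊢
    refine Polynomial.C_dvd_of_C_dvd_mul hn (fun c hc => ?_) hq
    rw [← Polynomial.C_dvd_C_iff, ← hb', ← (isolate A z).apply_symm_apply (Polynomial.C c),
      map_dvd_iff]
    refine h _ fun i => ?_
    rw [← map_dvd_iff (isolate A z), map_mul, AlgEquiv.apply_symm_apply, hb', hf',
      ← Polynomial.C_mul]
    exact map_dvd _ (hc i)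
  obtain ⟨b', hb'⟩ := exists_isolate_eq_C hby
  choose f' hf' using fun i => exists_isolate_eq_C (hfy i)
  have hg : isolate A y (∑ i, f i * X z ^ n i) =
      Polynomial.C (∑ i, f' i * X ⟨z, hyz⟩ ^ n i) := by
    simp [hf', isolate_X_of_ne hyz]
  rw [← MulEquiv.prime_iff (isolate A y), map_add, map_mul, hg, hb', isolate_X_self]
  refine Polynomial.prime_C_mul_X_add_C ?_ fun c hc => ?_
  · rintro rfl
    exact hb (by simpa using hb')
  · rw [← Polynomial.C_dvd_C_iff, ← hb', ← (isolate A y).apply_symm_apply (Polynomial.C c),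
      map_dvd_iff]
    refine hreg _ ?_
    rw [← map_dvd_iff (isolate A y), map_mul, AlgEquiv.apply_symm_apply, hb', hg,
      ← Polynomial.C_mul]
    exact map_dvd _ hc

/-- If `p = y`, setting `y` to zero would make `∑ f i z ^ n i` vanish, hence each `f i`. If `p ≠ y`,
the form has degree one in `y` while `X p` has degree zero. -/
lemma not_associated_linearForm [IsDomain A] {ι : Type*} [Fintype ι] [Nonempty ι]
    {b : MvPolynomial σ A} {f : ι → MvPolynomial σ A} {n : ι → ℕ} (hn : Function.Injective n)
    (hb : b ≠ 0) (hf : ∀ i, f i ≠ 0) {y z : σ} (hyz : z ≠ y)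
    (hby : y ∉ b.vars) (hfy : ∀ i, y ∉ (f i).vars) (hfz : ∀ i, z ∉ (f i).vars) (p : σ) :
    ¬ Associated (b * X y + ∑ i, f i * X z ^ n i) (X p) := by
  obtain ⟨b', hb'⟩ := exists_isolate_eq_C hby
  choose f' hf' using fun i => exists_isolate_eq_C (hfy i)
  have hg : isolate A y (∑ i, f i * X z ^ n i) =
      Polynomial.C (∑ i, f' i * X ⟨z, hyz⟩ ^ n i) := by
    simp [hf', isolate_X_of_ne hyz]
  intro h
  rcases eq_or_ne p y with rfl | hp
  · have hdvd := map_dvd (isolate A p) h.dvd'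
    rw [map_add, map_mul, hg, hb', isolate_X_self, Polynomial.X_dvd_iff] at hdvd
    have hzero : ∑ i, f i * X z ^ n i = 0 := by
      rw [← EmbeddingLike.map_eq_zero_iff (f := isolate A p), hg, Polynomial.C_eq_zero]
      rwa [Polynomial.coeff_add, Polynomial.mul_coeff_zero, Polynomial.coeff_X_zero, mul_zero,
        zero_add, Polynomial.coeff_C_zero] at hdvd
    choose k hk using fun i => exists_isolate_eq_C (hfz i)
    have h0 := congrArg (isolate A z) hzero
    simp only [map_mul, map_sum, map_pow, hk, isolate_X_self, map_zero] at h0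
    obtain ⟨j⟩ := ‹Nonempty ι›
    have hj := congrArg (Polynomial.coeff · (n j)) h0
    simp only [Polynomial.coeff_sum_C_mul_X_pow k hn j, Polynomial.coeff_zero] at hj
    exact hf j (by simpa [hj] using hk j)
  · have hdvd := map_dvd (isolate A y) h.dvd
    rw [map_add, map_mul, hg, hb', isolate_X_self, isolate_X_of_ne hp] at hdvd
    have hdeg := Polynomial.natDegree_le_of_dvd hdvd (by simp)
    rw [Polynomial.natDegree_linear, Polynomial.natDegree_C] at hdeg
    · omega
    · rintro rfl
      exact hb (by simpa using hb')

/-- A `v`-trivial ideal contains a prime element of the ideal of the variables that is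
not associated to a variable. -/
lemma exists_prime_mem [IsDomain A] [Infinite σ] {L : Ideal (MvPolynomial σ A)}
    {F : Finset (MvPolynomial σ A)} (hFL : (F : Set (MvPolynomial σ A)) ⊆ L) (h0 : 0 ∉ F)
    (h : ∀ c b : MvPolynomial σ A, b ≠ 0 → (∀ f ∈ F, b ∣ c * f) → b ∣ c) :
    ∃ q ∈ L, Prime q ∧ q ∈ Ideal.span (Set.range (X : σ → MvPolynomial σ A)) ∧
      ∀ p : σ, ¬ Associated q (X p) := by
  classical
  obtain ⟨b, hbF⟩ : F.Nonempty := by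
    rw [Finset.nonempty_iff_ne_empty]
    rintro rfl
    obtain ⟨y⟩ := (inferInstance : Nonempty σ)
    exact (X_prime (R := A) (i := y)).not_isUnit (isUnit_of_dvd_one
      (h 1 (X y) (X_prime (R := A) (i := y)).ne_zero (by simp)))
  have hne : ∀ f ∈ F, f ≠ 0 := fun f hf hf0 => h0 (hf0 ▸ hf)
  obtain ⟨y, hy⟩ := Infinite.exists_notMem_finset (F.biUnion vars)
  obtain ⟨z, hz⟩ := Infinite.exists_notMem_finset (insert y (F.biUnion vars))
  simp only [Finset.mem_insert, Finset.mem_biUnion, not_or, not_exists, not_and] at hy hz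
  -- The shift by one makes all exponents positive, so that the form lies in the ideal of the
  -- variables.
  obtain ⟨n, hn, hpos⟩ : ∃ n : F → ℕ, Function.Injective n ∧ ∀ f, 0 < n f :=
    ⟨fun f => (F.equivFin f : ℕ) + 1, (add_left_injective 1).comp
      (Fin.val_injective.comp F.equivFin.injective), fun _ => Nat.succ_pos _⟩
  have : Nonempty F := ⟨⟨b, hbF⟩⟩
  have hX : ∀ x, X x ∈ Ideal.span (Set.range (X : σ → MvPolynomial σ A)) :=
    fun x => Ideal.subset_span (Set.mem_range_self x)
  refine ⟨b * X y + ∑ f : F, f.1 * X z ^ n f, ?_, ?_, ?_, ?_⟩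
  · exact L.add_mem (L.mul_mem_right _ (hFL hbF))
      (L.sum_mem fun f _ => L.mul_mem_right _ (hFL f.2))
  · exact prime_linearForm (f := fun f : F => f.1) hn (hne b hbF)
      (fun c hc => h c b (hne b hbF) fun f hf => hc ⟨f, hf⟩) hz.1 (hy b hbF) (hz.2 b hbF)
      (fun f => hy f f.2) (fun f => hz.2 f f.2)
  · generalize Ideal.span (Set.range (X : σ → MvPolynomial σ A)) = I at hX
    exact I.add_mem (I.mul_mem_left b (hX y))
      (I.sum_mem fun f _ => I.mul_mem_left f.1 (I.pow_mem_of_mem (hX z) (n f) (hpos f)))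
  · exact not_associated_linearForm (f := fun f : F => f.1) hn (hne b hbF) (fun f => hne f f.2) hz.1 (hy b hbF)
      (fun f => hy f f.2) (fun f => hz.2 f f.2)

end MvPolynomial

/-! ### The semigroup algebra as a polynomial ring -/

section FreeComplementEquiv

variable {D H : Type*} [CommRing D] [CommMonoid H] {H₀ : Submonoid H} {P : Set H}

/-- The isomorphism `F(P) × H₀ ≃ H` given by an internal direct product. -/
noncomputable def IsFreeComplement.mulEquiv (h : IsFreeComplement H₀ P) :
    Multiplicative (P →₀ ℕ) × H₀ ≃* H :=
  MulEquiv.ofBijective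
    -- The free factor comes first, so that currying makes `D[H₀]` the coefficient ring.
    ({ toFun := fun x => (x.2 : H) * x.1.toAdd.prod (fun p n => (p : H) ^ n)
       map_one' := by simp
       map_mul' := fun x y => by
         rw [Prod.fst_mul, Prod.snd_mul, toAdd_mul,
           Finsupp.prod_add_index' (by simp) (fun _ _ _ => pow_add _ _ _), Submonoid.coe_mul,
           mul_mul_mul_comm] } : Multiplicative (P →₀ ℕ) × H₀ →* H)
    (h.comp (Prod.swap_bijective.comp
      (Multiplicative.toAdd.bijective.prodMap Function.bijective_id)))

lemma IsFreeComplement.mulEquiv_single (h : IsFreeComplement H₀ P) (p : P) :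
    h.mulEquiv (Multiplicative.ofAdd (Finsupp.single p 1), 1) = p := by
  simp [IsFreeComplement.mulEquiv]

lemma IsFreeComplement.mulEquiv_one (h : IsFreeComplement H₀ P) (x : H₀) :
    h.mulEquiv (1, x) = x := by
  simp [IsFreeComplement.mulEquiv]

/-- If `H = H₀ × F(P)` then `D[H]` is the polynomial ring over `D[H₀]` in the variables `P`. -/
noncomputable def IsFreeComplement.ringEquiv (D : Type*) [CommRing D]
    (h : IsFreeComplement H₀ P) :
    MonoidAlgebra D H ≃+* MvPolynomial P (MonoidAlgebra D H₀) :=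
  ((MonoidAlgebra.mapDomainRingEquiv D h.mulEquiv.symm).trans
    MonoidAlgebra.curryRingEquiv).trans (AddMonoidAlgebra.toMultiplicative _ _).symm

lemma IsFreeComplement.ringEquiv_of (h : IsFreeComplement H₀ P) (p : P) :
    h.ringEquiv D (MonoidAlgebra.of D H p) = MvPolynomial.X p := by
  have : h.mulEquiv.symm p = (Multiplicative.ofAdd (Finsupp.single p 1), 1) := by
    rw [MulEquiv.symm_apply_eq, h.mulEquiv_single]
  rw [IsFreeComplement.ringEquiv, RingEquiv.trans_apply, RingEquiv.trans_apply,
    MonoidAlgebra.of_apply, MonoidAlgebra.mapDomainRingEquiv_single, this,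
    MonoidAlgebra.curryRingEquiv_single, RingEquiv.symm_apply_eq]
  exact (AddMonoidAlgebra.toMultiplicative_single _ _).symm

lemma IsFreeComplement.ringEquiv_single (h : IsFreeComplement H₀ P) (x : H₀) (d : D) :
    h.ringEquiv D (MonoidAlgebra.single (x : H) d) =
      MvPolynomial.C (MonoidAlgebra.single x d) := by
  have : h.mulEquiv.symm x = (1, x) := by
    rw [MulEquiv.symm_apply_eq, h.mulEquiv_one]
  rw [IsFreeComplement.ringEquiv, RingEquiv.trans_apply, RingEquiv.trans_apply,
    MonoidAlgebra.mapDomainRingEquiv_single, this, MonoidAlgebra.curryRingEquiv_single,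
    RingEquiv.symm_apply_eq]
  exact (AddMonoidAlgebra.toMultiplicative_single _ _).symm

lemma IsFreeComplement.ringEquiv_image (h : IsFreeComplement H₀ P) :
    h.ringEquiv D '' (MonoidAlgebra.of D H '' P) = Set.range MvPolynomial.X := by
  ext f
  constructor
  · rintro ⟨_, ⟨p, hp, rfl⟩, rfl⟩
    exact ⟨⟨p, hp⟩, (h.ringEquiv_of ⟨p, hp⟩).symm⟩
  · rintro ⟨p, rfl⟩
    exact ⟨_, ⟨p, p.2, rfl⟩, h.ringEquiv_of p⟩

lemma IsFreeComplement.ringEquiv_mem_range_C (h : IsFreeComplement H₀ P) {f : MonoidAlgebra D H}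
    (hf : f ∈ MonoidAlgebra.supported D D (H₀ : Set H)) :
    ∃ a, h.ringEquiv D f = MvPolynomial.C a := by
  rw [MonoidAlgebra.supported_eq_span_single] at hf
  induction hf using Submodule.span_induction with
  | mem f hf =>
    obtain ⟨x, hx, rfl⟩ := hf
    exact ⟨_, h.ringEquiv_single ⟨x, hx⟩ 1⟩
  | zero => exact ⟨0, by simp⟩
  | add f g _ _ hf hg =>
    obtain ⟨a, ha⟩ := hf
    obtain ⟨b, hb⟩ := hg
    exact ⟨a + b, by rw [map_add, ha, hb, MvPolynomial.C_add]⟩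
  | smul d f _ hf =>
    obtain ⟨a, ha⟩ := hf
    refine ⟨MonoidAlgebra.single 1 d * a, ?_⟩
    have : d • f = MonoidAlgebra.single ((1 : H₀) : H) d * f := by
      ext x
      exact (MonoidAlgebra.coeff_single_one_mul f d x).symm
    rw [this, map_mul, h.ringEquiv_single, ha, MvPolynomial.C_mul]

lemma IsFreeComplement.isDomain_monoidAlgebra (h : IsFreeComplement H₀ P)
    [IsDomain (MonoidAlgebra D H)] : IsDomain (MonoidAlgebra D H₀) := by
  have := (h.ringEquiv D).symm.injective.comp
    (MvPolynomial.C_injective P (MonoidAlgebra D H₀))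
  exact Function.Injective.isDomain ((h.ringEquiv D).symm.toRingHom.comp MvPolynomial.C) this

end FreeComplementEquiv

/-! ### The multiplicative set and its invariance -/

section PrimesIn

variable {R : Type*} [CommRing R]

/-- The prime elements in the ideal generated by `X` that are not associated to elements of `X`. -/
def primesIn (X : Set R) : Set R :=
  {q | Prime q ∧ q ∈ Ideal.span X ∧ ∀ p ∈ X, ¬ Associated q p}

lemma closure_primesIn_le (X : Set R) {s : R} (hs : s ∈ Subsemigroup.closure (primesIn X)) :
    s ∈ Ideal.span X := by
  induction hs using Subsemigroup.closure_induction with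
  | mem s hs => exact hs.2.1
  | mul s t _ _ hs _ => exact Ideal.mul_mem_right _ _ hs

lemma zero_notMem_closure_primesIn [IsDomain R] (X : Set R) :
    (0 : R) ∉ Subsemigroup.closure (primesIn X) := by
  suffices ∀ s ∈ Subsemigroup.closure (primesIn X), s ≠ 0 from fun h => this 0 h rfl
  intro s hs
  induction hs using Subsemigroup.closure_induction with
  | mem s hs => exact hs.1.ne_zero
  | mul s t _ _ hs ht => exact mul_ne_zero hs ht

lemma not_dvd_of_mem_closure_primesIn [IsDomain R] {X : Set R} {p s : R} (hpX : p ∈ X)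
    (hp : Prime p) (hs : s ∈ Subsemigroup.closure (primesIn X)) : ¬ p ∣ s := by
  induction hs using Subsemigroup.closure_induction with
  | mem s hs => exact fun h => hs.2.2 p hpX (hp.associated_of_dvd hs.1 h).symm
  | mul s t _ _ hs ht => exact fun h => (hp.dvd_or_dvd h).elim hs ht

/-- An automorphism mapping `X` into itself preserves `primesIn X`, if `X` is minimal as a
generating set of the ideal it generates. -/
lemma image_closure_primesIn_subset {X : Set R} (hX : ∀ Y ⊆ X, ∀ p ∈ X, p ∈ Ideal.span Y → p ∈ Y)
    (φ : R ≃+* R) (hφ : φ '' X ⊆ X) :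
    φ '' (Subsemigroup.closure (primesIn X) : Set R) ⊆ Subsemigroup.closure (primesIn X) := by
  have hspan : ∀ q ∈ Ideal.span X, φ q ∈ Ideal.span (φ '' X) := by
    intro q hq
    have := Ideal.mem_map_of_mem (φ : R →+* R) hq
    rwa [Ideal.map_span] at this
  rintro _ ⟨s, hs, rfl⟩
  induction hs using Subsemigroup.closure_induction with
  | mem q hq =>
    refine Subsemigroup.subset_closure ⟨(MulEquiv.prime_iff φ).2 hq.1,
      Ideal.span_mono hφ (hspan q hq.2.1), fun p hp hqp => ?_⟩
    -- If `φ q` is associated to `p`, then `p` lies in the ideal generated by `φ(X)`, and minimality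
    -- of `X` puts `p` in `φ(X)`. This covers the case where `φ(X)` is strictly smaller than `X`.
    obtain ⟨p', hp', rfl⟩ := hX _ hφ p hp (Ideal.mem_of_dvd _ hqp.dvd (hspan q hq.2.1))
    refine hq.2.2 p' hp' ?_
    simpa using hqp.map φ.symm
  | mul s t _ _ hs ht =>
    rw [map_mul]
    exact mul_mem hs ht

lemma image_closure_primesIn_eq {X : Set R} (hX : ∀ Y ⊆ X, ∀ p ∈ X, p ∈ Ideal.span Y → p ∈ Y)
    (φ : R ≃+* R) (hφ : φ '' X = X) :
    φ '' (Subsemigroup.closure (primesIn X) : Set R) = Subsemigroup.closure (primesIn X) := by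
  refine (image_closure_primesIn_subset hX φ hφ.le).antisymm fun s hs => ?_
  have hsymm : φ.symm '' X ⊆ X := by
    conv_lhs => rw [← hφ]
    rintro _ ⟨_, ⟨x, hx, rfl⟩, rfl⟩
    simpa using hx
  exact ⟨φ.symm s, image_closure_primesIn_subset hX φ.symm hsymm ⟨s, hs, rfl⟩, by simp⟩

lemma mem_submonoidClosure_iff {S : Subsemigroup R} {x : R} :
    x ∈ Submonoid.closure (S : Set R) ↔ x = 1 ∨ x ∈ S := by
  refine ⟨fun hx => ?_, ?_⟩
  · induction hx using Submonoid.closure_induction with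
    | mem x hx => exact Or.inr hx
    | one => exact Or.inl rfl
    | mul x y _ _ hx hy =>
      rcases hx with rfl | hx
      · rwa [one_mul]
      · rcases hy with rfl | hy
        · exact Or.inr (by rwa [mul_one])
        · exact Or.inr (S.mul_mem hx hy)
  · rintro (rfl | hx)
    · exact one_mem _
    · exact Submonoid.subset_closure hx

lemma zero_notMem_submonoidClosure [Nontrivial R] {S : Subsemigroup R} (h : (0 : R) ∉ S) :
    (0 : R) ∉ Submonoid.closure (S : Set R) := by
  simp [mem_submonoidClosure_iff, h]

/-- An inverse of `p` would make `p` divide a denominator, but `p` divides no product of primes not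
associated to it. -/
lemma not_isField_localizationAt_closure_primesIn [IsDomain R] {X : Set R} {p : R} (hpX : p ∈ X)
    (hp : Prime p) : ¬ IsField (LocalizationAt (Subsemigroup.closure (primesIn X))) := by
  intro hT
  set S := Subsemigroup.closure (primesIn X)
  have hS : ∀ s ∈ Submonoid.closure (S : Set R), ¬ p ∣ s := by
    intro s hs
    induction hs using Submonoid.closure_induction with
    | mem s hs => exact not_dvd_of_mem_closure_primesIn hpX hp hs
    | one => exact hp.not_dvd_one
    | mul s t _ _ hs ht => exact fun h => (hp.dvd_or_dvd h).elim hs ht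
  have hle : Submonoid.closure (S : Set R) ≤ nonZeroDivisors R :=
    le_nonZeroDivisors_of_noZeroDivisors fun h => hS 0 h (dvd_zero p)
  have hinj := IsLocalization.injective (LocalizationAt S) hle
  have hne : algebraMap R (LocalizationAt S) p ≠ 0 := by
    rw [← map_zero (algebraMap R (LocalizationAt S))]
    exact hinj.ne hp.ne_zero
  obtain ⟨x, hx⟩ := hT.mul_inv_cancel hne
  obtain ⟨r, s, rfl⟩ := IsLocalization.exists_mk'_eq (Submonoid.closure (S : Set R)) x
  rw [← IsLocalization.mk'_one (M := Submonoid.closure (S : Set R)), ← IsLocalization.mk'_mul,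
    one_mul, IsLocalization.mk'_eq_iff_eq_mul, one_mul] at hx
  exact hS s s.2 ⟨r, (hinj hx).symm⟩

end PrimesIn

/-! ### The Dedekind localization of the semigroup algebra -/

section Localizer

variable {D H : Type*} [CommRing D] [CommMonoid H] {H₀ : Submonoid H} {P : Set H}

/-- A variable lying in an ideal generated by variables is one of the generators. -/
lemma IsFreeComplement.mem_of_mem_span [Nontrivial (MonoidAlgebra D H₀)]
    (h : IsFreeComplement H₀ P) :
    ∀ Y ⊆ MonoidAlgebra.of D H '' P, ∀ f ∈ MonoidAlgebra.of D H '' P, f ∈ Ideal.span Y →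
      f ∈ Y := by
  intro Y hY f hf hfY
  have hY' : h.ringEquiv D '' Y = MvPolynomial.X '' {p : P | MonoidAlgebra.of D H p ∈ Y} := by
    ext g
    constructor
    · rintro ⟨y, hy, rfl⟩
      obtain ⟨p, hp, rfl⟩ := hY hy
      exact ⟨⟨p, hp⟩, hy, (h.ringEquiv_of ⟨p, hp⟩).symm⟩
    · rintro ⟨p, hp, rfl⟩
      exact ⟨_, hp, h.ringEquiv_of p⟩
  obtain ⟨p, hp, rfl⟩ := hf
  have hmap := Ideal.mem_map_of_mem (h.ringEquiv D : MonoidAlgebra D H →+* MvPolynomial P (MonoidAlgebra D H₀)) hfY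
  rw [Ideal.map_span, RingEquiv.coe_toRingHom, hY', h.ringEquiv_of ⟨p, hp⟩,
    MvPolynomial.mem_ideal_span_X_image] at hmap
  obtain ⟨q, hq, hqp⟩ := hmap (Finsupp.single ⟨p, hp⟩ 1) (by simp [MvPolynomial.support_X])
  obtain rfl : q = ⟨p, hp⟩ := by
    by_contra hne
    exact hqp (Finsupp.single_eq_of_ne hne)
  exact hq

lemma IsFreeComplement.prime_of [IsDomain (MonoidAlgebra D H)] (h : IsFreeComplement H₀ P)
    {p : H} (hp : p ∈ P) : Prime (MonoidAlgebra.of D H p) := by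
  have := h.isDomain_monoidAlgebra (D := D)
  rw [← MulEquiv.prime_iff (h.ringEquiv D), h.ringEquiv_of ⟨p, hp⟩]
  exact MvPolynomial.X_prime

lemma IsFreeComplement.isDedekindLocalizer (h : IsFreeComplement H₀ P) (hP : P.Infinite)
    (hDH : IsKrullDomain (MonoidAlgebra D H)) :
    IsDedekindLocalizer H₀ (Subsemigroup.closure (primesIn (MonoidAlgebra.of D H '' P))) := by
  have := hDH.isDomain
  have := h.isDomain_monoidAlgebra (D := D)
  have : Infinite P := hP.to_subtype
  have hspan : (Ideal.span (MonoidAlgebra.of D H '' P)).map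
      (h.ringEquiv D : MonoidAlgebra D H →+* MvPolynomial P (MonoidAlgebra D H₀)) =
        Ideal.span (Set.range MvPolynomial.X) := by
    rw [Ideal.map_span, RingEquiv.coe_toRingHom, h.ringEquiv_image]
  have hmem : ∀ f, f ∈ Ideal.span (MonoidAlgebra.of D H '' P) ↔
      h.ringEquiv D f ∈ Ideal.span (Set.range MvPolynomial.X) := by
    intro f
    rw [← hspan]
    refine ⟨fun hf => Ideal.mem_map_of_mem _ hf, fun hf => ?_⟩
    obtain ⟨g, hg, hgf⟩ := (Ideal.mem_map_of_equiv (h.ringEquiv D) _).1 hf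
    rwa [← (h.ringEquiv D).injective hgf]
  obtain ⟨p, hp⟩ := hP.nonempty
  refine ⟨zero_notMem_closure_primesIn _, ⟨_, fun q hq => hq.1, rfl⟩, ?_, ?_,
    not_isField_localizationAt_closure_primesIn ⟨p, hp, rfl⟩ (h.prime_of hp)⟩
  -- Elements of `D[H₀]` are constant polynomials, while those of `S` have zero constant term; only
  -- zero could be common.
  · rw [Set.disjoint_left]
    intro f hfS hf
    obtain ⟨a, ha⟩ := h.ringEquiv_mem_range_C hf
    have hfX := (hmem f).1 (closure_primesIn_le _ hfS)
    rw [ha] at hfX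
    have : a = 0 := by
      have hker : Ideal.span (Set.range (MvPolynomial.X : P → MvPolynomial P (MonoidAlgebra D H₀)))
          ≤ RingHom.ker MvPolynomial.constantCoeff := by
        rw [Ideal.span_le]
        rintro _ ⟨x, rfl⟩
        simp
      simpa using hker hfX
    rw [this, map_zero, EmbeddingLike.map_eq_zero_iff] at ha
    exact zero_notMem_closure_primesIn _ (ha ▸ hfS)
  · set S := Subsemigroup.closure (primesIn (MonoidAlgebra.of D H '' P))
    refine hDH.isDedekindDomain_localization (Submonoid.closure S) ?_ _ fun L hL => ?_
    · exact zero_notMem_submonoidClosure (zero_notMem_closure_primesIn _)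
    · obtain ⟨F, hFL, h0, hF⟩ := hDH.exists_finset_forall_dvd L
      classical
      let e := h.ringEquiv D
      obtain ⟨q, hq, hprime, hqX, hqa⟩ := MvPolynomial.exists_prime_mem (F := F.image e)
        (L := L.comap (e.symm : _ →+* _)) (by
          intro f hf
          obtain ⟨g, hg, rfl⟩ := by simpa only [Finset.coe_image, Set.mem_image] using hf
          simpa using hFL hg) (by simpa using h0) (by
          intro c b hb hbc
          rw [← map_dvd_iff e.symm]
          have hb' : e.symm b ≠ 0 := by simpa using hb
          refine hL _ _ hb' (hF _ _ hb' fun f hf => ?_)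
          have := hbc (e f) (Finset.mem_image_of_mem e hf)
          rw [← map_dvd_iff e.symm] at this
          simpa using this)
      refine ⟨e.symm q, Submonoid.subset_closure (Subsemigroup.subset_closure
        ⟨(MulEquiv.prime_iff e.symm).2 hprime, (hmem _).2 ?_, ?_⟩), hq⟩
      · simpa [e] using hqX
      · rintro _ ⟨x, hx, rfl⟩ hass
        refine hqa ⟨x, hx⟩ ?_
        have := hass.map e
        rwa [RingEquiv.apply_symm_apply, h.ringEquiv_of ⟨x, hx⟩] at this

end Localizer

/-! ### Simplicity of Dedekind localizations -/

section Simple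

open nonZeroDivisors

variable {R : Type*} [CommRing R]

/-- The iterated preimages of `I` under `τ` ascend and hence stabilize; as taking preimages is
injective, already `τ⁻¹(I) = I`. -/
lemma IsVSimpleMonoid.eq_univ_of_image_subset {M : Type*} [CommMonoid M] {τ : M ≃* M}
    (hτ : IsVSimpleMonoid τ) (hM : IsKrullMonoid M) {I : Set M} (hI : IsDivisorialIdeal I)
    (hne : I.Nonempty) (hsub : τ '' I ⊆ I) : I = Set.univ := by
  have := hM.isCancelMul
  have hpre : ∀ J : Set M, IsDivisorialIdeal J → IsDivisorialIdeal (τ ⁻¹' J) := by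
    intro J hJ
    refine isDivisorialIdeal_iff.2 ((subset_dvdClosure _).antisymm' fun x hx => ?_)
    rw [Set.mem_preimage, ← hJ.dvdClosure_eq]
    intro a b hab
    have := hx (τ.symm a) (τ.symm b) fun i hi => by
      rw [← map_dvd_iff τ]
      simpa using hab (τ i) hi
    rw [← map_dvd_iff τ] at this
    simpa using this
  let J : ℕ → Set M := fun n => (Set.preimage τ)^[n] I
  have hJ : ∀ n, J (n + 1) = τ ⁻¹' J n := fun n => Function.iterate_succ_apply' _ _ _
  have hstep : ∀ n, J n ⊆ J (n + 1) := by
    intro n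
    induction n with
    | zero => exact Set.image_subset_iff.1 hsub
    | succ n ih =>
      rw [hJ, hJ (n + 1)]
      exact Set.preimage_mono ih
  obtain ⟨N, hN⟩ := hM.vNoetherian J (monotone_nat_of_le_succ hstep) (fun n => by
    induction n with
    | zero => exact hI
    | succ n ih => exact hJ n ▸ hpre _ ih)
  have hinj : Function.Injective (Set.preimage τ : Set M → Set M) :=
    Set.preimage_injective.2 τ.surjective
  have hfix : τ ⁻¹' I = I := by
    have h := hN (N + 1) N.le_succ
    exact hinj.iterate N (by rw [← Function.iterate_succ_apply]; exact h)
  by_contra hI'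
  refine hτ I hI hne hI' ?_
  conv_lhs => rw [← hfix]
  exact Set.image_preimage_eq I τ.surjective

/-- Contractions of nonzero ideals of a Dedekind localization of a Krull domain are divisorial. -/
lemma IsKrullDomain.isDivisorialIdeal_comap (hR : IsKrullDomain R) (S : Submonoid R)
    (h0 : 0 ∉ S) (T : Type*) [CommRing T] [Algebra R T] [IsLocalization S T] [IsDedekindDomain T]
    (I : Ideal T) (hI : I ≠ ⊥) : IsDivisorialIdeal {x : R⁰ | algebraMap R T x ∈ I} := by
  have := hR.isDomain
  have := hR.isKrullMonoid.isCancelMul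
  have hS : S ≤ R⁰ := le_nonZeroDivisors_of_noZeroDivisors h0
  have hinj : Function.Injective (algebraMap R T) := IsLocalization.injective T hS
  refine isDivisorialIdeal_iff.2 ((subset_dvdClosure _).antisymm' fun x hx => ?_)
  obtain ⟨d, hdI, hd⟩ : ∃ d, algebraMap R T d ∈ I ∧ d ≠ 0 := by
    refine Submodule.exists_mem_ne_zero_of_ne_bot (p := I.comap (algebraMap R T)) fun hbot => hI ?_
    rw [← IsLocalization.map_under S T I, Ideal.under_def, hbot, Ideal.map_bot]
  obtain ⟨J, hJ⟩ : I ∣ Ideal.span {algebraMap R T d} :=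
    Ideal.dvd_iff_le.2 ((Ideal.span_singleton_le_iff_mem _).2 hdI)
  obtain ⟨F, hFI, -, hF⟩ := hR.exists_finset_forall_dvd (I.comap (algebraMap R T))
  -- With `IJ = (d)`, the claim is `xJ ⊆ (d)`; cancelling `J` then gives `x ∈ I`. For `t = r / s`, a
  -- common denominator `s'` for the finite set `F` gives `d ∣ s' r f` for all `f ∈ F`, and this
  -- passes to the contraction of `I` and then to its closure, which contains `x`.
  have key : ∀ t ∈ J, algebraMap R T d ∣ algebraMap R T x * t := by
    intro t ht
    obtain ⟨r, s, rfl⟩ := IsLocalization.exists_mk'_eq S t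
    have hu : ∀ f : F, ∃ u, algebraMap R T f * algebraMap R T r = algebraMap R T d * u := by
      intro f
      obtain ⟨u, hu⟩ : algebraMap R T d ∣ algebraMap R T f * IsLocalization.mk' T r s := by
        rw [← Ideal.mem_span_singleton, hJ]
        exact Ideal.mul_mem_mul (hFI f.2) ht
      refine ⟨u * algebraMap R T s, ?_⟩
      rw [← mul_assoc, ← hu, mul_assoc, IsLocalization.mk'_spec]
    choose u hu using hu
    obtain ⟨s', hs'⟩ := IsLocalization.exist_integer_multiples_of_finite S u
    have hdvd : d ∣ s' * r * x := by
      rcases eq_or_ne r 0 with rfl | hr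
      · simp
      refine nonZeroDivisors_coe_dvd_iff.2 (hx (⟨s', hS s'.2⟩ * ⟨r, mem_nonZeroDivisors_of_ne_zero hr⟩)
        ⟨d, mem_nonZeroDivisors_of_ne_zero hd⟩ fun i hi => nonZeroDivisors_coe_dvd_iff.1
          (hF (s' * r) _ hd (fun f hf => ?_) i hi))
      obtain ⟨v, hv⟩ := hs' ⟨f, hf⟩
      refine ⟨v, hinj ?_⟩
      rw [map_mul, map_mul, map_mul, hv, Algebra.smul_def, mul_left_comm, ← hu, mul_assoc,
        mul_comm (algebraMap R T f)]
    have hdvd' := map_dvd (algebraMap R T) hdvd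
    rw [mul_assoc, map_mul, map_mul, (IsLocalization.map_units T s').dvd_mul_left,
      ← IsLocalization.mk'_spec T r s, mul_right_comm,
      (IsLocalization.map_units T s).dvd_mul_right, mul_comm] at hdvd'
    exact hdvd'
  have hle : Ideal.span {algebraMap R T x} * J ≤ I * J := by
    rw [← hJ, Ideal.mul_le]
    intro r hr t ht
    obtain ⟨c, rfl⟩ := Ideal.mem_span_singleton.1 hr
    rw [Ideal.mem_span_singleton, mul_right_comm]
    exact (key t ht).mul_right c
  have hJ0 : J ≠ ⊥ := by
    rintro rfl
    rw [Ideal.mul_bot, Ideal.span_singleton_eq_bot] at hJ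
    exact hd (hinj (by rw [hJ, map_zero]))
  exact (Ideal.span_singleton_le_iff_mem _).1 (Ideal.dvd_iff_le.1
    ((mul_dvd_mul_iff_right hJ0).1 (Ideal.dvd_iff_le.2 hle)))

/-- If `R` is `φ`-`v`-simple, a nonzero ideal of a Dedekind localization that is mapped into
itself by an extension of `φ` is the unit ideal. -/
lemma IsVSimple.eq_bot_or_eq_top {φ : R ≃+* R} (hφ : IsVSimple φ) (hR : IsKrullDomain R)
    (S : Submonoid R) (h0 : 0 ∉ S) {T : Type*} [CommRing T] [Algebra R T] [IsLocalization S T]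
    [IsDedekindDomain T] {σ : T → T} (hσ : ∀ r, σ (algebraMap R T r) = algebraMap R T (φ r))
    {I : Ideal T} (hI : ∀ x ∈ I, σ x ∈ I) : I = ⊥ ∨ I = ⊤ := by
  have := hR.isDomain
  have hS : S ≤ R⁰ := le_nonZeroDivisors_of_noZeroDivisors h0
  by_cases hI0 : I = ⊥
  · exact Or.inl hI0
  right
  have hcomap : I.comap (algebraMap R T) ≠ ⊥ := by
    intro hbot
    apply hI0
    rw [← IsLocalization.map_under S T I, Ideal.under_def, hbot, Ideal.map_bot]
  obtain ⟨a, haI, ha⟩ := Submodule.exists_mem_ne_zero_of_ne_bot hcomap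
  have huniv := IsVSimpleMonoid.eq_univ_of_image_subset hφ hR.isKrullMonoid
    (hR.isDivisorialIdeal_comap S h0 T I hI0) ⟨⟨a, mem_nonZeroDivisors_of_ne_zero ha⟩, haI⟩ (by
      rintro _ ⟨x, hx, rfl⟩
      have := hI _ hx
      rw [hσ] at this
      exact this)
  have h1 : (1 : R⁰) ∈ {x : R⁰ | algebraMap R T x ∈ I} := huniv ▸ Set.mem_univ _
  rw [Ideal.eq_top_iff_one]
  simpa using h1

end Simple

/-! ### Extending endomorphisms to the localization -/

section Extension

variable {R : Type*} [CommRing R] {S : Subsemigroup R}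

lemma isUnit_algebraMap_of_mem_closure {φ : R →+* R}
    (h : ∀ s ∈ S, IsUnit (algebraMap R (LocalizationAt S) (φ s)))
    (s : Submonoid.closure (S : Set R)) :
    IsUnit (((algebraMap R (LocalizationAt S)).comp φ) s) := by
  rcases mem_submonoidClosure_iff.1 s.2 with h1 | h1
  · simp [h1]
  · exact h s h1

/-- The extension of an endomorphism of `R` to a localization. -/
noncomputable def localizationAtMap (φ : R →+* R)
    (h : ∀ s ∈ S, IsUnit (algebraMap R (LocalizationAt S) (φ s))) :
    LocalizationAt S →+* LocalizationAt S :=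
  IsLocalization.lift (M := Submonoid.closure (S : Set R)) (isUnit_algebraMap_of_mem_closure h)

lemma localizationAtMap_algebraMap (φ : R →+* R)
    (h : ∀ s ∈ S, IsUnit (algebraMap R (LocalizationAt S) (φ s))) (r : R) :
    localizationAtMap φ h (algebraMap R (LocalizationAt S) r) =
      algebraMap R (LocalizationAt S) (φ r) :=
  IsLocalization.lift_eq _ _

lemma localizationAtMap_injective [IsDomain R] (h0 : (0 : R) ∉ S) (φ : R →+* R)
    (hφ : Function.Injective φ) (h : ∀ s ∈ S, IsUnit (algebraMap R (LocalizationAt S) (φ s))) :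
    Function.Injective (localizationAtMap φ h) := by
  have hinj : Function.Injective (algebraMap R (LocalizationAt S)) :=
    IsLocalization.injective _ (le_nonZeroDivisors_of_noZeroDivisors
      (zero_notMem_submonoidClosure h0))
  refine IsLocalization.lift_injective_iff _ |>.2 fun x y => ?_
  simp [hinj.eq_iff, hφ.eq_iff]

lemma localizationAtMap_comp {φ ψ : R →+* R} (hφψ : ψ.comp φ = RingHom.id R)
    (hφ : ∀ s ∈ S, IsUnit (algebraMap R (LocalizationAt S) (φ s)))
    (hψ : ∀ s ∈ S, IsUnit (algebraMap R (LocalizationAt S) (ψ s))) :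
    (localizationAtMap ψ hψ).comp (localizationAtMap φ hφ) = RingHom.id _ := by
  refine IsLocalization.ringHom_ext (Submonoid.closure (S : Set R)) ?_
  ext r
  have := congrArg (fun f => algebraMap R (LocalizationAt S) (f r)) hφψ
  simpa [localizationAtMap_algebraMap] using this

end Extension

theorem mainTheorem7 {D H : Type*} [CommRing D] [CommMonoid H]
    (hD : IsKrullDomain D) (hH : IsKrullMonoid H)
    (P : Set H) (hPc : P.Countable) (hPi : P.Infinite)
    (hPprime : ∀ p ∈ P, IsPrimeElement p)
    (hPna : P.Pairwise fun p q => ¬ Associated p q)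
    (hDH : IsKrullDomain (MonoidAlgebra D H)) :
    -- the decomposition `H = H₀ × F(P)` with a Krull monoid `H₀`
    (∃ H₀ : Submonoid H, IsFreeComplement H₀ P ∧ IsKrullMonoid H₀) ∧
    -- (1) and (2), for every such decomposition
    (∀ H₀ : Submonoid H, IsFreeComplement H₀ P →
      (∃ S : Subsemigroup (MonoidAlgebra D H), IsDedekindLocalizer H₀ S) ∧
      (∀ φ : MonoidAlgebra D H ≃+* MonoidAlgebra D H,
        φ '' (MonoidAlgebra.of D H '' P) ⊆ MonoidAlgebra.of D H '' P →
        ∃ S : Subsemigroup (MonoidAlgebra D H), IsDedekindLocalizer H₀ S ∧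
          φ '' (S : Set (MonoidAlgebra D H)) ⊆ S ∧
          (φ '' (MonoidAlgebra.of D H '' P) = MonoidAlgebra.of D H '' P →
            φ '' (S : Set (MonoidAlgebra D H)) = S))) ∧
    -- (3)
    (∀ S : Subsemigroup (MonoidAlgebra D H), (0 : MonoidAlgebra D H) ∉ S →
      IsDedekindDomain (LocalizationAt S) →
      ∀ φ : MonoidAlgebra D H ≃+* MonoidAlgebra D H, IsVSimple φ →
      (∀ s ∈ S, IsUnit (algebraMap (MonoidAlgebra D H) (LocalizationAt S) (φ s))) →
        -- `φ` extends to an injective endomorphism, and `S⁻¹ D[H]` is simple with respect to it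
        (∃ φS : LocalizationAt S →+* LocalizationAt S,
          (∀ f, φS (algebraMap (MonoidAlgebra D H) (LocalizationAt S) f) =
            algebraMap (MonoidAlgebra D H) (LocalizationAt S) (φ f)) ∧
          Function.Injective φS ∧ IsSigmaSimple φS) ∧
        -- if the inverse of `φ` also maps `S` to units, then `φ` extends to an automorphism,
        -- and `S⁻¹ D[H]` is simple with respect to it
        ((∀ s ∈ S, IsUnit (algebraMap (MonoidAlgebra D H) (LocalizationAt S) (φ.symm s))) →
          ∃ φS : LocalizationAt S ≃+* LocalizationAt S,
            (∀ f, φS (algebraMap (MonoidAlgebra D H) (LocalizationAt S) f) =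
              algebraMap (MonoidAlgebra D H) (LocalizationAt S) (φ f)) ∧
            ∀ I : Ideal (LocalizationAt S),
              φS '' (I : Set (LocalizationAt S)) = I → I = ⊥ ∨ I = ⊤)) := by
  have hdom := hDH.isDomain
  refine ⟨⟨_, hH.isFreeComplement_coprimeSubmonoid hPprime hPna, hH.coprimeSubmonoid hPprime⟩,
    fun H₀ hH₀ => ⟨⟨_, hH₀.isDedekindLocalizer hPi hDH⟩, fun φ hφ =>
      ⟨_, hH₀.isDedekindLocalizer hPi hDH, ?_, fun hφ' => ?_⟩⟩, fun S h0 hS φ hφ hφS => ⟨?_, ?_⟩⟩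
  · have := hH₀.isDomain_monoidAlgebra (D := D)
    exact image_closure_primesIn_subset hH₀.mem_of_mem_span φ hφ
  · have := hH₀.isDomain_monoidAlgebra (D := D)
    exact image_closure_primesIn_eq hH₀.mem_of_mem_span φ hφ'
  · refine ⟨localizationAtMap (φ : MonoidAlgebra D H →+* MonoidAlgebra D H) hφS,
      localizationAtMap_algebraMap _ hφS, localizationAtMap_injective h0 _ φ.injective hφS,
      fun I hI => ?_⟩
    refine hφ.eq_bot_or_eq_top hDH _ (zero_notMem_submonoidClosure h0)
      (σ := localizationAtMap (φ : MonoidAlgebra D H →+* MonoidAlgebra D H) hφS)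
      (localizationAtMap_algebraMap _ hφS) fun x hx => ?_
    have := Ideal.mem_map_of_mem
      (localizationAtMap (φ : MonoidAlgebra D H →+* MonoidAlgebra D H) hφS) hx
    rwa [hI] at this
  · intro hφS'
    refine ⟨RingEquiv.ofRingHom
      (localizationAtMap (φ : MonoidAlgebra D H →+* MonoidAlgebra D H) hφS)
      (localizationAtMap (φ.symm : MonoidAlgebra D H →+* MonoidAlgebra D H) hφS')
      (localizationAtMap_comp (by ext <;> simp) _ _) (localizationAtMap_comp (by ext <;> simp) _ _),
      localizationAtMap_algebraMap _ hφS, fun I hI => ?_⟩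
    refine hφ.eq_bot_or_eq_top hDH _ (zero_notMem_submonoidClosure h0)
      (σ := localizationAtMap (φ : MonoidAlgebra D H →+* MonoidAlgebra D H) hφS)
      (localizationAtMap_algebraMap _ hφS) fun x hx => ?_
    exact hI.le (Set.mem_image_of_mem _ hx)
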